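/- Let $N\ge 2$ be an integer, let $\alpha\in(0,\frac{\pi}{2}]$, and let $\phi_\infty:\mathbb{R}^{N-1}\to\mathbb{R}$ be continuous. Let $\mathbb{S}^{N-2}=\{\nu\in\mathbb{R}^{N-1} : |\nu|=1\}$ be the Euclidean unit sphere. A continuous function $u$ on $\mathbb{R}^{N-1}$ is a viscosity solution of the eikonal equation $$|Du(x)|=\cot\alpha,\qquad x\in\mathbb{R}^{N-1},$$ if for every $x\in\mathbb{R}^{N-1}$ and every function $\psi$ of class $C^1$ in a neighbourhood of $x$: $|D\psi(x)|\le\cot\alpha$ whenever $u-\psi$ has a local maximum at $x$, and $|D\psi(x)|\ge\cot\alpha$ whenever $u-\psi$ has a local minimum at $x$. The function $u$ is $1$-homogeneous if $u(\lambda x)=\lambda u(x)$ for all $\lambda>0$ and $x\in\mathbb{R}^{N-1}$. Then $\phi_\infty$ is a $1$-homogeneous viscosity solution of the eikonal equation if and only if there exists a sequence $(\nu_i)_{i\in\mathbb{N}}$ of points of $\mathbb{S}^{N-2}$ such that $$\phi_\infty(x)=\inf_{i\in\mathbb{N}}\bigl(-(\cot\alpha)\,\nu_i\cdot x\bigr)\qquad\text{for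 all }x\in\mathbb{R}^{N-1}.$$ -/

import Mathlib

namespace Eikonal

/-- A function `u` on `ℝⁿ` is positively homogeneous of degree `1`. -/
def IsOneHomogeneous {n : ℕ} (u : EuclideanSpace ℝ (Fin n) → ℝ) : Prop :=
  ∀ (t : ℝ) (x : EuclideanSpace ℝ (Fin n)), 0 < t → u (t • x) = t * u x

/-- `u` is a viscosity subsolution of `H(Du) = 0` in `ℝⁿ`: whenever `ψ` is of class `C¹` in a
neighbourhood of `x` and `u - ψ` has a local maximum at `x`, one has `H(Dψ(x)) ≤ 0`. -/
def IsViscositySubsolution {n : ℕ} (H : EuclideanSpace ℝ (Fin n) → ℝ)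
    (u : EuclideanSpace ℝ (Fin n) → ℝ) : Prop :=
  ∀ (x : EuclideanSpace ℝ (Fin n)) (ψ : EuclideanSpace ℝ (Fin n) → ℝ),
    ContDiffAt ℝ 1 ψ x → IsLocalMax (fun y => u y - ψ y) x → H (gradient ψ x) ≤ 0

/-- `u` is a viscosity supersolution of `H(Du) = 0` in `ℝⁿ`: whenever `ψ` is of class `C¹` in a
neighbourhood of `x` and `u - ψ` has a local minimum at `x`, one has `H(Dψ(x)) ≥ 0`. -/
def IsViscositySupersolution {n : ℕ} (H : EuclideanSpace ℝ (Fin n) → ℝ)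
    (u : EuclideanSpace ℝ (Fin n) → ℝ) : Prop :=
  ∀ (x : EuclideanSpace ℝ (Fin n)) (ψ : EuclideanSpace ℝ (Fin n) → ℝ),
    ContDiffAt ℝ 1 ψ x → IsLocalMin (fun y => u y - ψ y) x → 0 ≤ H (gradient ψ x)

/-- `u` is a continuous viscosity solution of `H(Du) = 0` in `ℝⁿ`. -/
def IsViscositySolution {n : ℕ} (H : EuclideanSpace ℝ (Fin n) → ℝ)
    (u : EuclideanSpace ℝ (Fin n) → ℝ) : Prop :=
  Continuous u ∧ IsViscositySubsolution H u ∧ IsViscositySupersolution H u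

/-- `u` is a viscosity solution of the eikonal equation `|Du| = cot α`, i.e. of
`|Du| - cot α = 0`, in `ℝⁿ`. -/
def IsEikonalSolution {n : ℕ} (α : ℝ) (u : EuclideanSpace ℝ (Fin n) → ℝ) : Prop :=
  IsViscositySolution (fun p => ‖p‖ - Real.cot α) u

end Eikonal

/-! Write `c` for `cot α`, so `c ≥ 0`. Given a homogeneous solution, the subsolution property makes
`u` `c`-Lipschitz, and for `c > 0` the supersolution property makes it drop by `c * r` somewhere on
every sphere of radius `r`. Lipschitz cones from such points on spheres with `r → ∞` flatten into a
plane of slope `c` lying above `u` and touching it at the centre (`exists_supporting_plane`).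
Homogeneity forces these planes through the origin; a dense set of touching points yields a
countable family. Conversely, an infimum of such planes is `c`-Lipschitz, hence a subsolution, and
by compactness of the sphere is touched from above at every point by a plane of slope `c`, hence a
supersolution. -/

namespace Eikonal

open Filter Topology Metric

/-! ### Radial test functions and gradient estimates -/

section Radial

variable {F : Type*} [NormedAddCommGroup F] [InnerProductSpace ℝ F]

theorem contDiffAt_radial {h : ℝ → ℝ} {x y : F} (hh : ContDiffAt ℝ 1 h (‖y - x‖ ^ 2)) :
    ContDiffAt ℝ 1 (fun z => h (‖z - x‖ ^ 2)) y :=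
  ContDiffAt.comp y hh ((contDiff_id.sub contDiff_const).norm_sq ℝ).contDiffAt

/-- Cones with a far vertex are nearly planes: the error vanishes as `t → ∞`. -/
theorem norm_sub_smul_le {z ν : F} (hν : ‖ν‖ = 1) {t : ℝ} (ht : 0 < t) :
    ‖z - t • ν‖ ≤ t - inner ℝ ν z + ‖z‖ ^ 2 / (2 * t) := by
  have h1 : ‖z - t • ν‖ ^ 2 = ‖z‖ ^ 2 - 2 * (t * inner ℝ ν z) + t ^ 2 := by
    rw [norm_sub_sq_real, inner_smul_right, norm_smul, hν, real_inner_comm]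
    simp
  have h2 : t - inner ℝ ν z + ‖z‖ ^ 2 / (2 * t) = (‖z - t • ν‖ ^ 2 + t ^ 2) / (2 * t) := by
    rw [h1]; field_simp; ring
  rw [h2, le_div_iff₀ (by positivity)]
  nlinarith [sq_nonneg (‖z - t • ν‖ - t)]

variable [CompleteSpace F]

theorem hasGradientAt_radial {h : ℝ → ℝ} {h' : ℝ} {x y : F}
    (hh : HasDerivAt h h' (‖y - x‖ ^ 2)) :
    HasGradientAt (fun z => h (‖z - x‖ ^ 2)) ((2 * h') • (y - x)) y := by
  have h1 : HasFDerivAt (fun z : F => ‖z - x‖ ^ 2) (2 • innerSL ℝ (y - x)) y := by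
    simpa using ((hasFDerivAt_id y).sub_const x).norm_sq
  rw [hasGradientAt_iff_hasFDerivAt]
  refine (hh.comp_hasFDerivAt y h1).congr_fderiv ?_
  ext z
  simp
  ring

/-- A differentiable function which decreases at most at rate `c` near `x` has gradient of norm at
most `c` there. -/
theorem norm_gradient_le_of_eventually {ψ : F → ℝ} {x : F} {c : ℝ} (hc : 0 ≤ c)
    (hψ : DifferentiableAt ℝ ψ x) (h : ∀ᶠ y in 𝓝 x, -(c * ‖y - x‖) ≤ ψ y - ψ x) :
    ‖gradient ψ x‖ ≤ c := by
  set g := gradient ψ x with hg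
  have hgrad : HasGradientAt ψ g x := hψ.hasGradientAt
  have hf : HasFDerivAt ψ (InnerProductSpace.toDual ℝ F g) x := hgrad.hasFDerivAt
  -- Test along steepest descent, where `ψ` has slope `-‖g‖ ^ 2`.
  have hline : HasDerivAt (fun t : ℝ => x - t • g) (-g) 0 := by
    simpa using ((hasDerivAt_id (0 : ℝ)).smul_const g).const_sub x
  have hcomp : HasDerivAt (fun t : ℝ => ψ (x - t • g)) (-(‖g‖ ^ 2)) 0 := by
    have hf' : HasFDerivAt ψ (InnerProductSpace.toDual ℝ F g) (x - (0 : ℝ) • g) := by simpa using hf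
    have := hf'.comp_hasDerivAt (0 : ℝ) hline
    simpa [Function.comp_def, real_inner_self_eq_norm_sq] using this
  have hev : ∀ᶠ t : ℝ in 𝓝[>] 0, -(c * ‖g‖) ≤ t⁻¹ • (ψ (x - (0 + t) • g) - ψ (x - (0 : ℝ) • g)) := by
    have ht : Tendsto (fun t : ℝ => x - t • g) (𝓝[>] 0) (𝓝 x) := by
      have := hline.continuousAt.tendsto
      simp only [zero_smul, sub_zero] at this
      exact this.mono_left nhdsWithin_le_nhds
    filter_upwards [ht.eventually h, self_mem_nhdsWithin] with t h1 h2
    have h2 : 0 < t := h2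
    simp only [sub_sub_cancel_left, norm_neg, norm_smul, Real.norm_eq_abs, abs_of_pos h2] at h1
    rw [zero_add, zero_smul, sub_zero, smul_eq_mul, inv_mul_eq_div, le_div_iff₀ h2]
    linarith
  have hlim := hcomp.tendsto_slope_zero_right
  have hle : -(c * ‖g‖) ≤ -(‖g‖ ^ 2) := ge_of_tendsto hlim hev
  by_contra! hlt
  nlinarith [norm_nonneg g]

/-- A hyperplane touching a differentiable function from above carries its gradient. -/
theorem gradient_eq_of_eventually_le {ψ : F → ℝ} {x p : F} (hψ : DifferentiableAt ℝ ψ x)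
    (h : ∀ᶠ y in 𝓝 x, ψ y - ψ x ≤ inner ℝ p (y - x)) : gradient ψ x = p := by
  have hp : HasFDerivAt (fun y => inner ℝ p y) (InnerProductSpace.toDual ℝ F p) x :=
    (InnerProductSpace.toDual ℝ F p).hasFDerivAt
  have hf := hψ.hasGradientAt.hasFDerivAt.sub hp
  have hmax : IsLocalMax (ψ - fun y => inner ℝ p y) x := by
    filter_upwards [h] with y hy
    simp only [Pi.sub_apply]
    rw [inner_sub_right] at hy
    linarith
  have h0 := hmax.hasFDerivAt_eq_zero hf
  exact (InnerProductSpace.toDual ℝ F).injective (sub_eq_zero.1 h0)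

end Radial

variable {n : ℕ} {c : ℝ} {u : EuclideanSpace ℝ (Fin n) → ℝ}

/-! ### From homogeneous solutions to infima of planes -/

theorem IsOneHomogeneous.map_zero (hu : IsOneHomogeneous u) : u 0 = 0 := by
  have := hu 2 0 two_pos
  rw [smul_zero] at this
  linarith

theorem IsOneHomogeneous.exists_le_mul_norm (hu : IsOneHomogeneous u) (hcont : Continuous u) :
    ∃ M : ℝ, 0 ≤ M ∧ ∀ x, u x ≤ M * ‖x‖ := by
  obtain ⟨M, hM⟩ := (isCompact_sphere (0 : EuclideanSpace ℝ (Fin n)) 1).bddAbove_image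
    hcont.continuousOn
  refine ⟨max M 0, le_max_right _ _, fun x => ?_⟩
  rcases eq_or_ne x 0 with rfl | hx
  · simp [hu.map_zero]
  have hx' : 0 < ‖x‖ := norm_pos_iff.2 hx
  have h1 : u (‖x‖⁻¹ • x) ≤ M := hM ⟨_, by simp [norm_smul, hx'.ne'], rfl⟩
  have h2 := hu ‖x‖ (‖x‖⁻¹ • x) hx'
  rw [smul_inv_smul₀ hx'.ne'] at h2
  rw [h2, mul_comm]
  exact mul_le_mul_of_nonneg_right (h1.trans (le_max_left _ _)) hx'.le

/-- A subsolution of `|Du| = c` of at most linear growth is `c`-Lipschitz. -/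
theorem IsViscositySubsolution.le_add_mul_norm (hc : 0 ≤ c) (hcont : Continuous u)
    (hsub : IsViscositySubsolution (fun p => ‖p‖ - c) u) {M : ℝ} (hM0 : 0 ≤ M)
    (hM : ∀ x, u x ≤ M * ‖x‖) (x y : EuclideanSpace ℝ (Fin n)) :
    u y ≤ u x + c * ‖y - x‖ := by
  have key : ∀ δ > 0, u y ≤ u x + ((c + δ) * ‖y - x‖ + δ * ‖y - x‖ ^ 2) := by
    intro δ hδ
    -- The quadratic term beats the linear growth of `u`, so `u - ψ` attains its maximum. Away from
    -- the vertex `ψ` is smooth with slope above `c`, so the maximum point must be `x`.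
    set h : ℝ → ℝ := fun s => (c + δ) * √s + δ * s with hh
    set ψ : EuclideanSpace ℝ (Fin n) → ℝ := fun z => h (‖z - x‖ ^ 2) with hψ
    have hψx : ∀ z, ψ z = (c + δ) * ‖z - x‖ + δ * ‖z - x‖ ^ 2 := fun z => by
      simp [hψ, hh, Real.sqrt_sq (norm_nonneg _)]
    have hψcont : Continuous ψ := by
      simp only [hψ, hh]; fun_prop
    have hlim : Tendsto (fun z => u z - ψ z) (cocompact _) atBot := by
      have hb : ∀ z, u z - ψ z ≤ M * ‖x‖ + (M * ‖z - x‖ - δ * ‖z - x‖ ^ 2) := fun z => by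
        rw [hψx]
        have h1 : ‖z‖ ≤ ‖z - x‖ + ‖x‖ := norm_le_norm_sub_add z x
        have h2 := mul_le_mul_of_nonneg_left h1 hM0
        have h3 : 0 ≤ (c + δ) * ‖z - x‖ := by positivity
        linarith [hM z]
      refine tendsto_atBot_mono hb (tendsto_atBot_add_const_left _ _ ?_)
      have hn : Tendsto (fun z : EuclideanSpace ℝ (Fin n) => ‖z - x‖) (cocompact _) atTop := by
        refine tendsto_atTop_mono (fun z => norm_sub_norm_le z x) ?_
        exact tendsto_atTop_add_const_right _ (-‖x‖) tendsto_norm_cocompact_atTop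
      have hp : Tendsto (fun s : ℝ => M * s - δ * s ^ 2) atTop atBot := by
        have h1 : Tendsto (fun s : ℝ => M - δ * s) atTop atBot :=
          tendsto_atBot_add_const_left _ M
            (tendsto_neg_atTop_atBot.comp (tendsto_id.const_mul_atTop hδ))
        refine (tendsto_id.atTop_mul_atBot₀ h1).congr fun s => ?_
        simp only [id]; ring
      exact hp.comp hn
    obtain ⟨z, hz⟩ := (hcont.sub hψcont).exists_forall_ge hlim
    have hzx : z = x := by
      by_contra hne
      have hpos : 0 < ‖z - x‖ := norm_pos_iff.2 (sub_ne_zero.2 hne)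
      have hsq : ‖z - x‖ ^ 2 ≠ 0 := by positivity
      have hder : HasDerivAt h ((c + δ) * (1 / (2 * √(‖z - x‖ ^ 2))) + δ * 1) (‖z - x‖ ^ 2) :=
        ((Real.hasDerivAt_sqrt hsq).const_mul _).add ((hasDerivAt_id _).const_mul _)
      have hC1 : ContDiffAt ℝ 1 h (‖z - x‖ ^ 2) :=
        (contDiffAt_const.mul (Real.contDiffAt_sqrt hsq)).add (contDiffAt_const.mul contDiffAt_id)
      have hle := hsub z ψ (contDiffAt_radial hC1) (Eventually.of_forall hz)
      beta_reduce at hle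
      rw [(hasGradientAt_radial hder).gradient, Real.sqrt_sq hpos.le, norm_smul,
        Real.norm_of_nonneg (by positivity)] at hle
      have : 2 * ((c + δ) * (1 / (2 * ‖z - x‖)) + δ * 1) * ‖z - x‖ =
          c + δ + 2 * δ * ‖z - x‖ := by field_simp
      rw [this] at hle
      have : 0 < δ * ‖z - x‖ := by positivity
      linarith
    have hy : u y - ψ y ≤ u z - ψ z := hz y
    rw [hzx, hψx, hψx, sub_self, norm_zero] at hy
    linarith
  have hlim : Tendsto (fun δ : ℝ => u x + ((c + δ) * ‖y - x‖ + δ * ‖y - x‖ ^ 2)) (𝓝[>] 0)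
      (𝓝 (u x + ((c + 0) * ‖y - x‖ + 0 * ‖y - x‖ ^ 2))) :=
    (Continuous.tendsto (by fun_prop) 0).mono_left nhdsWithin_le_nhds
  have := ge_of_tendsto hlim (eventually_mem_nhdsWithin.mono key)
  simpa using this

/-- A supersolution of `|Du| = c` decreases at rate `c` towards some point of each sphere. -/
theorem IsViscositySupersolution.exists_mem_sphere_le (hc : 0 < c) (hcont : Continuous u)
    (hsuper : IsViscositySupersolution (fun p => ‖p‖ - c) u) (hn : 0 < n)
    (x : EuclideanSpace ℝ (Fin n)) {r : ℝ} (hr : 0 < r) :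
    ∃ y ∈ sphere x r, u y ≤ u x - c * r := by
  have : NeZero n := ⟨hn.ne'⟩
  obtain ⟨y, hy, hmin⟩ := (isCompact_sphere x r).exists_isMinOn
    (NormedSpace.sphere_nonempty.2 hr.le) hcont.continuousOn
  refine ⟨y, hy, ?_⟩
  have key : ∀ ε > 0, u y ≤ u x - c * (√(ε ^ 2 + r ^ 2) - √(ε ^ 2)) := by
    intro ε hε
    -- A smoothed cone of slope strictly below `c` everywhere, vertex included: `u - ψ` has no
    -- interior minimum, so its minimum over the ball lies on the sphere.
    set h : ℝ → ℝ := fun s => -c * √(ε ^ 2 + s) with hh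
    set ψ : EuclideanSpace ℝ (Fin n) → ℝ := fun z => h (‖z - x‖ ^ 2) with hψ
    have hψcont : Continuous ψ := by
      simp only [hψ, hh]; fun_prop
    obtain ⟨z, hz, hzmin⟩ := (isCompact_closedBall x r).exists_isMinOn
      (nonempty_closedBall.2 hr.le) (hcont.sub hψcont).continuousOn
    have hzs : z ∈ sphere x r := by
      by_contra hns
      have hzb : z ∈ ball x r :=
        mem_ball.2 (lt_of_le_of_ne (mem_closedBall.1 hz) (fun h => hns (mem_sphere.2 h)))
      have hpos : 0 < ε ^ 2 + ‖z - x‖ ^ 2 := by positivity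
      have hder : HasDerivAt h (-c * (1 / (2 * √(ε ^ 2 + ‖z - x‖ ^ 2)))) (‖z - x‖ ^ 2) := by
        have := ((hasDerivAt_id (‖z - x‖ ^ 2)).const_add (ε ^ 2)).sqrt hpos.ne'
        exact this.const_mul _
      have hC1 : ContDiffAt ℝ 1 h (‖z - x‖ ^ 2) :=
        contDiffAt_const.mul ((contDiffAt_const.add contDiffAt_id).sqrt hpos.ne')
      have hloc : IsLocalMin (fun w => u w - ψ w) z := by
        filter_upwards [isOpen_ball.mem_nhds hzb] with w hw
        exact hzmin (ball_subset_closedBall hw)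
      have hle := hsuper z ψ (contDiffAt_radial hC1) hloc
      have hS : 0 < √(ε ^ 2 + ‖z - x‖ ^ 2) := Real.sqrt_pos.2 hpos
      beta_reduce at hle
      rw [(hasGradientAt_radial hder).gradient, norm_smul] at hle
      have habs : ‖2 * (-c * (1 / (2 * √(ε ^ 2 + ‖z - x‖ ^ 2))))‖ =
          c / √(ε ^ 2 + ‖z - x‖ ^ 2) := by
        rw [show 2 * (-c * (1 / (2 * √(ε ^ 2 + ‖z - x‖ ^ 2)))) =
          -(c / √(ε ^ 2 + ‖z - x‖ ^ 2)) by field_simp, norm_neg,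
          Real.norm_of_nonneg (by positivity)]
      have hlt : ‖z - x‖ < √(ε ^ 2 + ‖z - x‖ ^ 2) :=
        Real.lt_sqrt_of_sq_lt (by nlinarith)
      rw [habs, div_mul_eq_mul_div, sub_nonneg, le_div_iff₀ hS] at hle
      exact absurd (le_of_mul_le_mul_left hle hc) (not_le.2 hlt)
    have h1 : u z - ψ z ≤ u x - ψ x := hzmin (mem_closedBall_self hr.le)
    have h2 : u y ≤ u z := hmin hzs
    simp only [hψ, hh, mem_sphere_iff_norm.1 hzs, sub_self, norm_zero, ne_eq,
      OfNat.ofNat_ne_zero, not_false_eq_true, zero_pow, add_zero] at h1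
    linarith
  have hlim : Tendsto (fun ε : ℝ => u x - c * (√(ε ^ 2 + r ^ 2) - √(ε ^ 2))) (𝓝[>] 0)
      (𝓝 (u x - c * (√(0 ^ 2 + r ^ 2) - √(0 ^ 2)))) :=
    (Continuous.tendsto (by fun_prop) 0).mono_left nhdsWithin_le_nhds
  have := ge_of_tendsto hlim (eventually_mem_nhdsWithin.mono key)
  simpa [Real.sqrt_sq hr.le] using this

/-- If `u` is `c`-Lipschitz and decreases at rate `c` towards a point of each sphere around `x`,
then a hyperplane of slope `c` touches `u` from above at `x`. -/
theorem exists_supporting_plane (hc : 0 ≤ c) (hlip : ∀ x y, u y ≤ u x + c * ‖y - x‖)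
    {x : EuclideanSpace ℝ (Fin n)}
    (hdesc : ∀ r : ℝ, 0 < r → ∃ y ∈ sphere x r, u y ≤ u x - c * r) :
    ∃ ν ∈ sphere (0 : EuclideanSpace ℝ (Fin n)) 1, ∀ y, u y ≤ u x - c * inner ℝ ν (y - x) := by
  have hν : ∀ k : ℕ, ∃ ν ∈ sphere (0 : EuclideanSpace ℝ (Fin n)) 1, ∀ y,
      u y ≤ u x - c * inner ℝ ν (y - x) + c * (‖y - x‖ ^ 2 / (2 * ((k : ℝ) + 1))) := by
    intro k
    have hk : (0 : ℝ) < k + 1 := by positivity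
    obtain ⟨w, hw, hle⟩ := hdesc (k + 1) hk
    have hnorm : ‖((k : ℝ) + 1)⁻¹ • (w - x)‖ = 1 := by
      rw [norm_smul, mem_sphere_iff_norm.1 hw, norm_inv, Real.norm_of_nonneg hk.le,
        inv_mul_cancel₀ hk.ne']
    refine ⟨((k : ℝ) + 1)⁻¹ • (w - x), mem_sphere_zero_iff_norm.2 hnorm, fun y => ?_⟩
    have h1 := norm_sub_smul_le (z := y - x) hnorm hk
    rw [smul_inv_smul₀ hk.ne', sub_sub_sub_cancel_right] at h1
    have h2 := mul_le_mul_of_nonneg_left h1 hc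
    linarith [hlip w y]
  choose ν hmem hle using hν
  obtain ⟨μ, hμ, σ, hσ, hlim⟩ := (isCompact_sphere _ _).tendsto_subseq hmem
  refine ⟨μ, hμ, fun y => ?_⟩
  have h1 : Tendsto (fun k => u x - c * inner ℝ (ν (σ k)) (y - x)) atTop
      (𝓝 (u x - c * inner ℝ μ (y - x))) :=
    ((hlim.inner tendsto_const_nhds).const_mul c).const_sub _
  have h2 : Tendsto (fun k : ℕ => c * (‖y - x‖ ^ 2 / (2 * ((k : ℝ) + 1)))) atTop (𝓝 0) := by
    have h3 : Tendsto (fun k : ℕ => 2 * ((k : ℝ) + 1)) atTop atTop :=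
      (tendsto_atTop_add_const_right _ 1 tendsto_natCast_atTop_atTop).const_mul_atTop two_pos
    simpa using (h3.const_div_atTop (‖y - x‖ ^ 2)).const_mul c
  have h3 := h1.add (h2.comp hσ.tendsto_atTop)
  rw [add_zero] at h3
  exact ge_of_tendsto' h3 fun k => hle (σ k) y

/-- The supporting planes of a positively homogeneous function pass through the origin. -/
theorem IsOneHomogeneous.eq_of_supporting_plane (hu : IsOneHomogeneous u)
    {x p : EuclideanSpace ℝ (Fin n)} (h : ∀ y, u y ≤ u x + inner ℝ p (y - x)) :
    u x = inner ℝ p x := by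
  -- Doubling and halving `x` give the two opposite inequalities.
  have h1 := h ((2 : ℝ) • x)
  have h2 := h ((1 / 2 : ℝ) • x)
  rw [hu _ _ (by norm_num), inner_sub_right, inner_smul_right] at h1 h2
  linarith

theorem exists_isGLB_of_solution (hn : 0 < n) (hc : 0 ≤ c) (hu : IsOneHomogeneous u)
    (hsol : IsViscositySolution (fun p => ‖p‖ - c) u) :
    ∃ ν : ℕ → sphere (0 : EuclideanSpace ℝ (Fin n)) 1, ∀ x,
      IsGLB (Set.range fun i : ℕ => -c * inner ℝ (ν i : EuclideanSpace ℝ (Fin n)) x) (u x) := by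
  obtain ⟨hcont, hsub, hsuper⟩ := hsol
  obtain ⟨M, hM0, hM⟩ := hu.exists_le_mul_norm hcont
  have hlip := hsub.le_add_mul_norm hc hcont hM0 hM
  have hdesc : ∀ (x : EuclideanSpace ℝ (Fin n)) (r : ℝ), 0 < r →
      ∃ y ∈ sphere x r, u y ≤ u x - c * r := by
    intro x r hr
    rcases hc.eq_or_lt with rfl | hc'
    -- For `c = 0` the Lipschitz bound alone suffices.
    · have : NeZero n := ⟨hn.ne'⟩
      obtain ⟨y, hy⟩ := (NormedSpace.sphere_nonempty (x := x)).2 hr.le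
      exact ⟨y, hy, by simpa using hlip x y⟩
    · exact hsuper.exists_mem_sphere_le hc' hcont hn x hr
  have hplane : ∀ x, ∃ ν : sphere (0 : EuclideanSpace ℝ (Fin n)) 1,
      u x = -c * inner ℝ (ν : EuclideanSpace ℝ (Fin n)) x ∧
      ∀ y, u y ≤ -c * inner ℝ (ν : EuclideanSpace ℝ (Fin n)) y := by
    intro x
    obtain ⟨ν, hν, h⟩ := exists_supporting_plane hc hlip (hdesc x)
    have hx : u x = -c * inner ℝ ν x := by
      rw [← real_inner_smul_left]
      refine hu.eq_of_supporting_plane fun y => ?_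
      rw [real_inner_smul_left]
      linarith [h y]
    refine ⟨⟨ν, hν⟩, hx, fun y => ?_⟩
    have := h y
    rw [inner_sub_right] at this
    linarith
  choose ν hν hle using hplane
  refine ⟨fun i => ν (TopologicalSpace.denseSeq _ i), fun x => ⟨?_, fun b hb => ?_⟩⟩
  · rintro _ ⟨i, rfl⟩
    exact hle _ x
  -- The plane touching at `z` changes by at most `c * ‖x - z‖` between `z` and `x`; density then
  -- allows `y = x`.
  have hclosed : IsClosed {y | b ≤ u y + c * ‖x - y‖} :=
    isClosed_le continuous_const (by fun_prop)
  have hall : ∀ y, b ≤ u y + c * ‖x - y‖ := by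
    intro y
    refine hclosed.closure_subset_iff.2 ?_ (TopologicalSpace.denseRange_denseSeq _ y)
    rintro _ ⟨i, rfl⟩
    set z := TopologicalSpace.denseSeq (EuclideanSpace ℝ (Fin n)) i
    have h1 : b ≤ -c * inner ℝ (ν z : EuclideanSpace ℝ (Fin n)) x := hb ⟨i, rfl⟩
    have h2 := hν z
    have h3 : -inner ℝ (ν z : EuclideanSpace ℝ (Fin n)) (x - z) ≤ ‖x - z‖ := by
      have := neg_le_of_abs_le (abs_real_inner_le_norm (ν z : EuclideanSpace ℝ (Fin n)) (x - z))
      rw [norm_eq_of_mem_sphere, one_mul] at this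
      linarith
    have h4 := mul_le_mul_of_nonneg_left h3 hc
    rw [inner_sub_right] at h4
    simp only [Set.mem_ofPred_eq]
    linarith
  simpa using hall x

/-! ### From infima of planes to homogeneous solutions -/

theorem isOneHomogeneous_of_isGLB {ν : ℕ → sphere (0 : EuclideanSpace ℝ (Fin n)) 1}
    (hu : ∀ x, IsGLB
      (Set.range fun i : ℕ => -c * inner ℝ (ν i : EuclideanSpace ℝ (Fin n)) x) (u x)) :
    IsOneHomogeneous u := by
  have hle : ∀ (t : ℝ) (x : EuclideanSpace ℝ (Fin n)), 0 < t → t * u x ≤ u (t • x) := by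
    intro t x ht
    refine (hu (t • x)).2 ?_
    rintro _ ⟨i, rfl⟩
    have h1 : u x ≤ -c * inner ℝ (ν i : EuclideanSpace ℝ (Fin n)) x := (hu x).1 ⟨i, rfl⟩
    have h2 := mul_le_mul_of_nonneg_left h1 ht.le
    simp only [inner_smul_right]
    linarith
  intro t x ht
  refine le_antisymm ?_ (hle t x ht)
  have h1 := hle t⁻¹ (t • x) (inv_pos.2 ht)
  rwa [inv_smul_smul₀ ht.ne', inv_mul_le_iff₀ ht] at h1

theorem le_add_mul_norm_of_isGLB (hc : 0 ≤ c)
    {ν : ℕ → sphere (0 : EuclideanSpace ℝ (Fin n)) 1}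
    (hu : ∀ x, IsGLB
      (Set.range fun i : ℕ => -c * inner ℝ (ν i : EuclideanSpace ℝ (Fin n)) x) (u x))
    (x y : EuclideanSpace ℝ (Fin n)) : u y ≤ u x + c * ‖y - x‖ := by
  rw [← sub_le_iff_le_add]
  refine (hu x).2 ?_
  rintro _ ⟨i, rfl⟩
  have h1 : u y ≤ -c * inner ℝ (ν i : EuclideanSpace ℝ (Fin n)) y := (hu y).1 ⟨i, rfl⟩
  have h3 : -inner ℝ (ν i : EuclideanSpace ℝ (Fin n)) (y - x) ≤ ‖y - x‖ := by
    have := neg_le_of_abs_le (abs_real_inner_le_norm (ν i : EuclideanSpace ℝ (Fin n)) (y - x))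
    rw [norm_eq_of_mem_sphere, one_mul] at this
    linarith
  have h4 := mul_le_mul_of_nonneg_left h3 hc
  rw [inner_sub_right] at h4
  simp only
  linarith

/-- The infimum need not be attained in the family, but a minimizing sequence of directions
subconverges on the compact sphere. -/
theorem exists_touching_plane_of_isGLB {ν : ℕ → sphere (0 : EuclideanSpace ℝ (Fin n)) 1}
    (hu : ∀ x, IsGLB
      (Set.range fun i : ℕ => -c * inner ℝ (ν i : EuclideanSpace ℝ (Fin n)) x) (u x))
    (x : EuclideanSpace ℝ (Fin n)) :
    ∃ μ ∈ sphere (0 : EuclideanSpace ℝ (Fin n)) 1,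
      u x = -c * inner ℝ μ x ∧ ∀ y, u y ≤ -c * inner ℝ μ y := by
  obtain ⟨v, -, -, hv, hmem⟩ := (hu x).exists_seq_antitone_tendsto (Set.range_nonempty _)
  choose i hi using hmem
  obtain ⟨μ, hμ, σ, hσ, hlim⟩ := (isCompact_sphere (0 : EuclideanSpace ℝ (Fin n)) 1).tendsto_subseq
    (fun k => (ν (i k)).2)
  have hin : ∀ y, Tendsto (fun k => -c * inner ℝ (ν (i (σ k)) : EuclideanSpace ℝ (Fin n)) y) atTop
      (𝓝 (-c * inner ℝ μ y)) := fun y => (hlim.inner tendsto_const_nhds).const_mul (-c)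
  refine ⟨μ, hμ, ?_, fun y => ?_⟩
  · refine tendsto_nhds_unique (hv.comp hσ.tendsto_atTop) ((hin x).congr fun k => ?_)
    exact hi (σ k)
  · exact ge_of_tendsto' (hin y) fun k => (hu y).1 ⟨_, rfl⟩

theorem isViscositySolution_of_isGLB (hc : 0 ≤ c) (hcont : Continuous u)
    {ν : ℕ → sphere (0 : EuclideanSpace ℝ (Fin n)) 1}
    (hu : ∀ x, IsGLB
      (Set.range fun i : ℕ => -c * inner ℝ (ν i : EuclideanSpace ℝ (Fin n)) x) (u x)) :
    IsViscositySolution (fun p => ‖p‖ - c) u := by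
  refine ⟨hcont, fun x ψ hψ hmax => ?_, fun x ψ hψ hmin => ?_⟩
  · refine sub_nonpos.2 (norm_gradient_le_of_eventually hc
      (hψ.differentiableAt one_ne_zero) ?_)
    filter_upwards [hmax] with y hy
    have := le_add_mul_norm_of_isGLB hc hu y x
    rw [norm_sub_rev] at this
    linarith
  · obtain ⟨μ, hμ, hx, hle⟩ := exists_touching_plane_of_isGLB hu x
    -- Up to a constant, `ψ` lies below `u` near `x`, and `u` below the touching plane.
    have hg : gradient ψ x = -c • μ := by
      refine gradient_eq_of_eventually_le (hψ.differentiableAt one_ne_zero) ?_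
      filter_upwards [hmin] with y hy
      rw [real_inner_smul_left, inner_sub_right]
      linarith [hle y]
    beta_reduce
    rw [hg, norm_smul, mem_sphere_zero_iff_norm.1 hμ, norm_neg, Real.norm_of_nonneg hc]
    simp

end Eikonal

theorem proposition2p2 (N : ℕ) (hN : 2 ≤ N) (α : ℝ) (hα : α ∈ Set.Ioc 0 (Real.pi / 2))
    (φ : EuclideanSpace ℝ (Fin (N - 1)) → ℝ) (hφ : Continuous φ) :
    (Eikonal.IsOneHomogeneous φ ∧ Eikonal.IsEikonalSolution α φ) ↔
      ∃ ν : ℕ → Metric.sphere (0 : EuclideanSpace ℝ (Fin (N - 1))) 1,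
        ∀ x : EuclideanSpace ℝ (Fin (N - 1)),
          IsGLB (Set.range fun i : ℕ =>
            -(Real.cot α) * inner ℝ (ν i : EuclideanSpace ℝ (Fin (N - 1))) x) (φ x) := by
  have hc : 0 ≤ Real.cot α := by
    rw [Real.cot_eq_cos_div_sin]
    exact div_nonneg (Real.cos_nonneg_of_mem_Icc ⟨by linarith [hα.1, Real.pi_pos], hα.2⟩)
      (Real.sin_nonneg_of_nonneg_of_le_pi hα.1.le (by linarith [hα.2, Real.pi_pos]))
  constructor
  · rintro ⟨hhom, hsol⟩
    exact Eikonal.exists_isGLB_of_solution (by omega) hc hhom hsol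
  · rintro ⟨ν, hν⟩
    exact ⟨Eikonal.isOneHomogeneous_of_isGLB hν, Eikonal.isViscositySolution_of_isGLB hc hφ hν⟩
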